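/- (The Whitney Embedding Theorem) Let $n \ge 0$ and let $M$ be a smooth ($C^\infty$) manifold of dimension $n$ (without boundary) that is paracompact, Hausdorff and connected. Then there exists a proper smooth embedding $\Psi : M \to \mathbb{R}^{2n+1}$; that is, $\Psi$ is a smooth immersion, a homeomorphism onto its image $\Psi(M)$ with the subspace topology, and $\Psi^{-1}(K)$ is compact for every compact $K \subseteq \mathbb{R}^{2n+1}$. -/

import Mathlib

open scoped Manifold ContDiff

/-!
# A proper smooth embedding of an `n`-manifold into `ℝ^(2n+1)`

A connected paracompact manifold `M` is σ-compact, so it carries a smooth function `f` with compact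
sublevel sets, and a sequence of bounded smooth functions `F k` with locally finite supports that
separates points and tangent vectors (`exists_isSeparatingFamily`: bump functions and their products
with local coordinates). The embedding has the form `Ψ = f • e + ∑ k, F k • a k` with `e` a unit
vector and vectors `a k` so small that `‖Ψ - f • e‖ ≤ 1`. Hence `Ψ` is proper.

The vectors `a k` are chosen one at a time, so no intermediate high-dimensional embedding is needed.
Given the partial sum `G`, an equation `G x + F k x • a = G y + F k y • a` with `F k x ≠ F k y`
determines `a` as a smooth function of the `2n` real parameters `(x, y)`. Likewise
`dG(v) + dF k(v) • a = 0` with `dF k(v) ≠ 0` determines `a` from the tangent vector `v`. The bad `a`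
thus form a set of Hausdorff dimension at most `2n`, whose complement in `ℝ^(2n+1)` is dense
(`exists_norm_lt_add_smul_injective`). For good choices, `Ψ x = Ψ y` forces `F k x = F k y` for every
`k`, hence `x = y`, and `dΨ(v) = 0` forces `dF k(v) = 0` for every `k`, hence `v = 0`
(`exists_contMDiff_injective_fderiv_injective_near`).

Finally, an injective differential provides the slice charts in the definition of an immersion by the
inverse function theorem (`ContMDiff.isImmersionAtOfComplement_of_injective_fderiv`), and an
injective proper map is a closed embedding.
-/

open Set Filter Topology Module

/-! ### Exhaustions -/

/-- Starting from one member of a locally finite cover by relatively compact open sets, adjoin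
repeatedly all members that meet what has been reached so far. Only finitely many are adjoined
each time, and the union of all stages is open and closed. -/
theorem sigmaCompactSpace_of_paracompactSpace_of_connectedSpace (X : Type*) [TopologicalSpace X]
    [ParacompactSpace X] [T2Space X] [LocallyCompactSpace X] [ConnectedSpace X] :
    SigmaCompactSpace X := by
  have hnhds : ∀ x : X, ∃ U : Set X, IsOpen U ∧ x ∈ U ∧ IsCompact (closure U) := by
    intro x
    obtain ⟨K, hK, hxK⟩ := exists_compact_mem_nhds x
    exact ⟨interior K, isOpen_interior, mem_interior_iff_mem_nhds.2 hxK,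
      hK.closure_of_subset interior_subset⟩
  choose U hUo hxU hUc using hnhds
  obtain ⟨V, hVo, hVcov, hVfin, hVU⟩ :=
    precise_refinement U hUo (iUnion_eq_univ_iff.2 fun x => ⟨x, hxU x⟩)
  have hVc : ∀ i, IsCompact (closure (V i)) := fun i =>
    (hUc i).of_isClosed_subset isClosed_closure (closure_mono (hVU i))
  let x₀ : X := Classical.arbitrary X
  let next : Set X → Set X := fun K => ⋃ i ∈ {i | (V i ∩ K).Nonempty}, closure (V i)
  let K : ℕ → Set X := fun k => next^[k] {x₀}
  have hK_succ : ∀ k, K (k + 1) = next (K k) := fun k => Function.iterate_succ_apply' _ _ _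
  have hKc : ∀ k, IsCompact (K k) := by
    intro k
    induction k with
    | zero => exact isCompact_singleton
    | succ k ih =>
      rw [hK_succ]
      exact (hVfin.finite_nonempty_inter_compact ih).isCompact_biUnion fun i _ => hVc i
  have hVK : ∀ i k, (V i ∩ K k).Nonempty → V i ⊆ K (k + 1) := by
    intro i k h
    rw [hK_succ]
    exact subset_closure.trans (subset_biUnion_of_mem (u := fun i => closure (V i)) h)
  have hopen : IsOpen (⋃ k, K k) := by
    refine isOpen_iff_mem_nhds.2 fun x hx => ?_
    obtain ⟨k, hk⟩ := mem_iUnion.1 hx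
    obtain ⟨i, hi⟩ := iUnion_eq_univ_iff.1 hVcov x
    exact mem_of_superset ((hVo i).mem_nhds hi)
      ((hVK i k ⟨x, hi, hk⟩).trans (subset_iUnion K _))
  have hclosed : IsClosed (⋃ k, K k) := by
    refine isClosed_of_closure_subset fun x hx => ?_
    obtain ⟨i, hi⟩ := iUnion_eq_univ_iff.1 hVcov x
    obtain ⟨y, hyV, hy⟩ := mem_closure_iff.1 hx _ (hVo i) hi
    obtain ⟨k, hk⟩ := mem_iUnion.1 hy
    exact mem_iUnion.2 ⟨k + 1, hVK i k ⟨y, hyV, hk⟩ hi⟩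
  have huniv : ⋃ k, K k = univ :=
    IsClopen.eq_univ ⟨hclosed, hopen⟩ ⟨x₀, mem_iUnion.2 ⟨0, mem_singleton x₀⟩⟩
  exact SigmaCompactSpace.of_countable (range K) (countable_range K)
    (forall_mem_range.2 hKc) (by rwa [sUnion_range])

section Manifold

variable {E : Type*} [NormedAddCommGroup E] [NormedSpace ℝ E] [FiniteDimensional ℝ E]
  {E' : Type*} [NormedAddCommGroup E'] [NormedSpace ℝ E']
  {M : Type*} [TopologicalSpace M] [ChartedSpace E M] [IsManifold 𝓘(ℝ, E) ∞ M]

variable (E M) in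
/-- The index of the first member of a compact exhaustion containing `x` is locally bounded, so a
partition of unity yields a smooth function above it. -/
theorem exists_contMDiff_isCompact_sublevel [T2Space M] [SigmaCompactSpace M] :
    ∃ f : M → ℝ, ContMDiff 𝓘(ℝ, E) 𝓘(ℝ) ∞ f ∧ ∀ r, IsCompact {x | f x ≤ r} := by
  have : LocallyCompactSpace M := ChartedSpace.locallyCompactSpace E M
  let K : CompactExhaustion M := default
  obtain ⟨f, hf⟩ := exists_contMDiffMap_forall_mem_convex_of_local_const (n := ⊤) 𝓘(ℝ, E)
    (t := fun x : M => Ici (K.find x : ℝ)) (fun x => convex_Ici _) fun x =>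
      ⟨(K.find x + 1 : ℕ), by
        filter_upwards [mem_interior_iff_mem_nhds.1 (K.subset_interior_succ _ (K.mem_find x))]
          with y hy
        exact (Nat.cast_le (α := ℝ)).2 (K.mem_iff_find_le.1 hy)⟩
  refine ⟨f, f.contMDiff, fun r => ?_⟩
  obtain ⟨k, hk⟩ := exists_nat_ge r
  refine (K.isCompact k).of_isClosed_subset
    (isClosed_le f.contMDiff.continuous continuous_const) fun x hx => ?_
  exact K.mem_iff_find_le.2 (Nat.cast_le.1 ((hf x).trans (le_trans hx hk)))

/-! ### Exceptional parameters -/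

theorem dimH_image_le_finrank_of_contDiffAt {f : E → E'} {s : Set E}
    (hf : ∀ x ∈ s, ContDiffAt ℝ 1 f x) : dimH (f '' s) ≤ finrank ℝ E :=
  calc
    dimH (f '' s) ≤ dimH s := dimH_image_le_of_locally_lipschitzOn fun x hx =>
      let ⟨C, t, ht, hC⟩ := (hf x hx).exists_lipschitzOnWith
      ⟨C, t, mem_nhdsWithin_of_mem_nhds ht, hC⟩
    _ ≤ dimH (univ : Set E) := dimH_mono (subset_univ s)
    _ = finrank ℝ E := Real.dimH_univ_eq_finrank E

omit [FiniteDimensional ℝ E] in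
theorem ContMDiff.contDiffAt_comp_chartAt_symm {G : M → E'}
    (hG : ContMDiff 𝓘(ℝ, E) 𝓘(ℝ, E') ∞ G) (c : M) {u : E} (hu : u ∈ (chartAt E c).target) :
    ContDiffAt ℝ ∞ (G ∘ (chartAt E c).symm) u := by
  have h := (hG.contMDiffOn (s := univ)).comp (contMDiffOn_chart_symm (I := 𝓘(ℝ, E)) (x := c))
    (subset_univ _)
  exact (contMDiffOn_iff_contDiffOn.1 h).contDiffAt ((chartAt E c).open_target.mem_nhds hu)

/-- Both bad events force `a` into a set parametrized by `2 * dim E` real variables: if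
`F x ≠ F y`, then `G x + F x • a = G y + F y • a` determines `a` as a smooth function of `(x, y)`,
and if `dF(v) ≠ 0`, then `dG(v) + dF(v) • a = 0` determines `a` as a smooth function of the
tangent vector `v`. So the bad parameters have Hausdorff dimension less than `dim E'`. -/
theorem exists_norm_lt_add_smul_injective [FiniteDimensional ℝ E']
    (hdim : 2 * finrank ℝ E < finrank ℝ E') {ι : Type*} [Countable ι] {c : ι → M}
    (hc : ∀ x, ∃ i, x ∈ (chartAt E (c i)).source)
    {G : M → E'} (hG : ContMDiff 𝓘(ℝ, E) 𝓘(ℝ, E') ∞ G)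
    {F : M → ℝ} (hF : ContMDiff 𝓘(ℝ, E) 𝓘(ℝ) ∞ F) {ε : ℝ} (hε : 0 < ε) :
    ∃ a : E', ‖a‖ < ε ∧
      (∀ x y, G x + F x • a = G y + F y • a → F x = F y) ∧
      ∀ i, ∀ u ∈ (chartAt E (c i)).target, ∀ v : E,
        fderiv ℝ ((fun x => G x + F x • a) ∘ (chartAt E (c i)).symm) u v = 0 →
          fderiv ℝ (F ∘ (chartAt E (c i)).symm) u v = 0 := by
  let φ : ι → OpenPartialHomeomorph M E := fun i => chartAt E (c i)
  have hGφ : ∀ i, ∀ u ∈ (φ i).target, ContDiffAt ℝ ∞ (G ∘ (φ i).symm) u := fun i u hu =>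
    hG.contDiffAt_comp_chartAt_symm _ hu
  have hFφ : ∀ i, ∀ u ∈ (φ i).target, ContDiffAt ℝ ∞ (F ∘ (φ i).symm) u := fun i u hu =>
    hF.contDiffAt_comp_chartAt_symm _ hu
  -- `B` collects the parameters bad for a pair of points, `T` those bad for a tangent vector.
  let B : ι × ι → Set E' := fun p =>
    (fun z : E × E => ((F ∘ (φ p.1).symm) z.1 - (F ∘ (φ p.2).symm) z.2)⁻¹ •
      ((G ∘ (φ p.2).symm) z.2 - (G ∘ (φ p.1).symm) z.1)) ''
    {z | z.1 ∈ (φ p.1).target ∧ z.2 ∈ (φ p.2).target ∧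
      (F ∘ (φ p.1).symm) z.1 - (F ∘ (φ p.2).symm) z.2 ≠ 0}
  let T : ι → Set E' := fun i =>
    (fun z : E × E => -(fderiv ℝ (F ∘ (φ i).symm) z.1 z.2)⁻¹ •
      fderiv ℝ (G ∘ (φ i).symm) z.1 z.2) ''
    {z | z.1 ∈ (φ i).target ∧ fderiv ℝ (F ∘ (φ i).symm) z.1 z.2 ≠ 0}
  have hfin : finrank ℝ (E × E) = 2 * finrank ℝ E := by rw [finrank_prod, two_mul]
  have hB : ∀ p, dimH (B p) ≤ (2 * finrank ℝ E : ℕ) := by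
    intro p
    rw [← hfin]
    refine dimH_image_le_finrank_of_contDiffAt fun z hz => ?_
    have h1 := ((hFφ p.1 z.1 hz.1).of_le (m := 1) (by simp)).comp z contDiffAt_fst
    have h2 := ((hFφ p.2 z.2 hz.2.1).of_le (m := 1) (by simp)).comp z contDiffAt_snd
    have h3 := ((hGφ p.1 z.1 hz.1).of_le (m := 1) (by simp)).comp z contDiffAt_fst
    have h4 := ((hGφ p.2 z.2 hz.2.1).of_le (m := 1) (by simp)).comp z contDiffAt_snd
    exact ((h1.sub h2).inv hz.2.2).smul (h4.sub h3)
  have hT : ∀ i, dimH (T i) ≤ (2 * finrank ℝ E : ℕ) := by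
    intro i
    rw [← hfin]
    refine dimH_image_le_finrank_of_contDiffAt fun z hz => ?_
    have h1 : ContDiffAt ℝ 1 (fun z : E × E => fderiv ℝ (F ∘ (φ i).symm) z.1 z.2) z :=
      (((hFφ i z.1 hz.1).fderiv_right (m := 1) (by norm_cast)).comp z
        contDiffAt_fst).clm_apply contDiffAt_snd
    have h2 : ContDiffAt ℝ 1 (fun z : E × E => fderiv ℝ (G ∘ (φ i).symm) z.1 z.2) z :=
      (((hGφ i z.1 hz.1).fderiv_right (m := 1) (by norm_cast)).comp z
        contDiffAt_fst).clm_apply contDiffAt_snd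
    exact (h1.inv hz.2).neg.smul h2
  have hbad : dimH ((⋃ p, B p) ∪ ⋃ i, T i) < finrank ℝ E' := by
    rw [dimH_union, dimH_iUnion, dimH_iUnion]
    exact (max_le (iSup_le hB) (iSup_le hT)).trans_lt (Nat.cast_lt.2 hdim)
  obtain ⟨a, ha, haε⟩ := (dense_compl_of_dimH_lt_finrank hbad).exists_mem_open
    (Metric.isOpen_ball (x := (0 : E')) (ε := ε)) ⟨0, Metric.mem_ball_self hε⟩
  rw [mem_compl_iff, mem_union, not_or, mem_iUnion, mem_iUnion, not_exists, not_exists] at ha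
  refine ⟨a, mem_ball_zero_iff.1 haε, fun x y h => ?_, fun i u hu v h => ?_⟩
  · by_contra hne
    obtain ⟨i, hi⟩ := hc x
    obtain ⟨j, hj⟩ := hc y
    refine ha.1 (i, j) ⟨(φ i x, φ j y), ⟨(φ i).map_source hi, (φ j).map_source hj, ?_⟩, ?_⟩
    · simpa [(φ i).left_inv hi, (φ j).left_inv hj, sub_eq_zero] using hne
    · simp only [Function.comp_apply, (φ i).left_inv hi, (φ j).left_inv hj]
      rw [inv_smul_eq_iff₀ (sub_ne_zero.2 hne), sub_smul, sub_eq_sub_iff_add_eq_add, ← h,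
        add_comm]
  · by_contra hne
    refine ha.2 i ⟨(u, v), ⟨hu, hne⟩, ?_⟩
    have h1 := ((hGφ i u hu).differentiableAt (by simp)).hasFDerivAt
    have h2 := ((hFφ i u hu).differentiableAt (by simp)).hasFDerivAt
    have h3 := (h1.add (h2.smul_const a)).fderiv
    have h4 : fderiv ℝ (G ∘ (φ i).symm) u v + fderiv ℝ (F ∘ (φ i).symm) u v • a = 0 := by
      rw [← h]
      exact (congrArg (fun L : E →L[ℝ] E' => L v) h3).symm
    change -(fderiv ℝ (F ∘ (φ i).symm) u v)⁻¹ • fderiv ℝ (G ∘ (φ i).symm) u v = a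
    rw [eq_neg_of_add_eq_zero_left h4, neg_smul_neg, inv_smul_smul₀ hne]

/-! ### Families of functions separating points and tangent vectors -/

/-- A sequence of bounded smooth functions on `M`, with locally finite supports, that separates
the points and the tangent vectors of `M`. Tangent vectors at `x` are read in one of the charts
with centres `c i`. -/
structure IsSeparatingFamily {ι : Type*} (c : ι → M) (F : ℕ → M → ℝ) : Prop where
  contMDiff : ∀ k, ContMDiff 𝓘(ℝ, E) 𝓘(ℝ) ∞ (F k)
  bounded : ∀ k, ∃ C, ∀ x, |F k x| ≤ C
  locallyFinite : LocallyFinite fun k => Function.support (F k)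
  eq_of_forall_eq : ∀ x y, (∀ k, F k x = F k y) → x = y
  exists_chart : ∀ x, ∃ i, x ∈ (chartAt E (c i)).source ∧
    ∀ v : E, (∀ k, fderiv ℝ (F k ∘ (chartAt E (c i)).symm) (chartAt E (c i) x) v = 0) → v = 0

variable (E M) in
/-- Bump functions equal to `1` on small neighbourhoods covering `M`, and their products with the
coordinate functions of the charts in which they are supported. -/
theorem exists_isSeparatingFamily [T2Space M] [SigmaCompactSpace M] :
    ∃ (s : Set M) (F : ℕ → M → ℝ), s.Countable ∧
      IsSeparatingFamily (E := E) (Subtype.val : s → M) F := by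
  obtain ⟨ι, f, -⟩ := SmoothBumpCovering.exists_isSubordinate 𝓘(ℝ, E) (isClosed_univ (X := M))
    (U := fun _ => univ) fun _ _ => univ_mem
  have hι : Countable ι :=
    countable_univ_iff.1 (f.locallyFinite.countable_univ fun i => (f i).nonempty_support)
  let φ : ι → OpenPartialHomeomorph M E := fun i => chartAt E (f.c i)
  let l : Fin (finrank ℝ E) → E →L[ℝ] ℝ := fun j =>
    LinearMap.toContinuousLinearMap ((finBasis ℝ E).coord j)
  have hl : ∀ u v : E, (∀ j, l j u = l j v) → u = v := fun u v h =>
    (finBasis ℝ E).ext_elem h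
  -- `none` indexes the bump function itself, `some j` its product with the `j`-th coordinate.
  let g : ι × Option (Fin (finrank ℝ E)) → M → ℝ := fun q x =>
    q.2.elim 1 fun j => l j (φ q.1 x)
  let P : ι × Option (Fin (finrank ℝ E)) → M → ℝ := fun q x => f q.1 x • g q x
  have hg : ∀ q, ContMDiffOn 𝓘(ℝ, E) 𝓘(ℝ) ∞ (g q) (φ q.1).source := by
    rintro ⟨i, _ | j⟩
    · exact contMDiffOn_const
    · exact (l j).contMDiff.comp_contMDiffOn (contMDiffOn_chart (I := 𝓘(ℝ, E)))
  have hP : ∀ q, ContMDiff 𝓘(ℝ, E) 𝓘(ℝ) ∞ (P q) := fun q => (f q.1).contMDiff_smul (hg q)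
  obtain ⟨e, he⟩ := exists_injective_nat (ι × Option (Fin (finrank ℝ E)))
  let F : ℕ → M → ℝ := Function.extend e P 0
  have hFe : ∀ q, F (e q) = P q := fun q => he.extend_apply P 0 q
  have hF : ∀ k, F k = 0 ∨ ∃ q, e q = k ∧ F k = P q := by
    intro k
    by_cases hk : ∃ q, e q = k
    · obtain ⟨q, rfl⟩ := hk
      exact Or.inr ⟨q, rfl, hFe q⟩
    · exact Or.inl (Function.extend_apply' P (0 : ℕ → M → ℝ) k hk)
  refine ⟨range f.c, F, countable_range _, fun k => ?_, fun k => ?_, fun x => ?_,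
    fun x y h => ?_, fun x => ?_⟩
  · rcases hF k with h | ⟨q, -, h⟩
    · rw [h]; exact contMDiff_const
    · rw [h]; exact hP q
  · rcases hF k with h | ⟨q, -, h⟩
    · exact ⟨0, fun x => by simp [h]⟩
    · obtain ⟨C, hC⟩ := ((f q.1).hasCompactSupport.smul_right (f' := g q)
        ).exists_bound_of_continuous (hP q).continuous
      exact ⟨C, fun x => by rw [h]; exact hC x⟩
  · obtain ⟨U, hU, hfin⟩ := f.locallyFinite x
    refine ⟨U, hU, ((hfin.prod finite_univ).image e).subset ?_⟩
    rintro k ⟨y, hy, hyU⟩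
    rcases hF k with h | ⟨q, rfl, h⟩
    · simp [h] at hy
    · change y ∈ Function.support (F (e q)) at hy
      rw [h] at hy
      exact ⟨q, ⟨⟨y, left_ne_zero_of_smul hy, hyU⟩, mem_univ _⟩, rfl⟩
  · have hP' : ∀ q, P q x = P q y := fun q => by rw [← hFe]; exact h _
    let i := f.ind x (mem_univ x)
    have hx1 : f i x = 1 := f.apply_ind x (mem_univ x)
    have hy1 : f i y = 1 := by
      have := hP' (i, none)
      simpa [P, g, hx1] using this.symm
    refine (φ i).injOn (f.mem_chartAt_source_of_eq_one hx1) (f.mem_chartAt_source_of_eq_one hy1)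
      (hl _ _ fun j => ?_)
    have := hP' (i, some j)
    simpa [P, g, hx1, hy1] using this
  · let i := f.ind x (mem_univ x)
    have hx : x ∈ (φ i).source := f.mem_chartAt_ind_source x (mem_univ x)
    refine ⟨⟨f.c i, mem_range_self i⟩, hx, fun v hv => hl _ _ fun j => ?_⟩
    -- Near `x` the `i`-th bump function is `1`, so the product is the coordinate function.
    have hev : P (i, some j) ∘ (φ i).symm =ᶠ[𝓝 (φ i x)] l j := by
      have h1 : ∀ᶠ u in 𝓝 (φ i x), f i ((φ i).symm u) = 1 := by
        have hcont := (φ i).continuousAt_symm ((φ i).map_source hx)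
        rw [ContinuousAt, (φ i).left_inv hx] at hcont
        exact hcont.eventually (f.eventuallyEq_one x (mem_univ x))
      filter_upwards [h1, (φ i).open_target.mem_nhds ((φ i).map_source hx)] with u hu hut
      simp [P, g, hu, (φ i).right_inv hut]
    have := hv (e (i, some j))
    rw [hFe] at this
    change fderiv ℝ (P (i, some j) ∘ (φ i).symm) (φ i x) v = 0 at this
    rw [hev.fderiv_eq, (l j).fderiv] at this
    rw [this, map_zero]

/-! ### Correcting a map step by step -/

/-- The map is `G₀ + ∑ k, F k • a k`, where the `a k` are chosen one after the other. Once
`F k • a k` has been added, equal values at `x` and `y` force `F k x = F k y`, so the difference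
of the values at `x` and `y` is the one before the addition, and the same reasoning applies to
the previous stages. Tangent vectors are handled in the same way. -/
theorem exists_contMDiff_injective_fderiv_injective_near [FiniteDimensional ℝ E']
    (hdim : 2 * finrank ℝ E < finrank ℝ E') {ι : Type*} [Countable ι] {c : ι → M}
    {F : ℕ → M → ℝ} (hF : IsSeparatingFamily (E := E) c F)
    {G₀ : M → E'} (hG₀ : ContMDiff 𝓘(ℝ, E) 𝓘(ℝ, E') ∞ G₀) :
    ∃ Ψ : M → E', ContMDiff 𝓘(ℝ, E) 𝓘(ℝ, E') ∞ Ψ ∧ (∀ x, ‖Ψ x - G₀ x‖ ≤ 1) ∧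
      Function.Injective Ψ ∧ ∀ x, ∃ i, x ∈ (chartAt E (c i)).source ∧
        Function.Injective
          (fderiv ℝ (Ψ ∘ (chartAt E (c i)).symm) (chartAt E (c i) x)) := by
  choose C hC using hF.bounded
  -- With `‖a k‖` below this bound, `‖F k x • a k‖ ≤ 2⁻ᵏ⁻¹`, and these sum to `1`.
  have hε : ∀ k, 0 < (1 / 2 : ℝ) ^ (k + 1) / (|C k| + 1) := fun k => by positivity
  choose a ha_norm ha_inj ha_der using
    fun (k : ℕ) (G : {G : M → E' // ContMDiff 𝓘(ℝ, E) 𝓘(ℝ, E') ∞ G}) =>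
      exists_norm_lt_add_smul_injective hdim
        (fun x => (hF.exists_chart x).imp fun _ h => h.1) G.2 (hF.contMDiff k) (hε k)
  let S : ℕ → {G : M → E' // ContMDiff 𝓘(ℝ, E) 𝓘(ℝ, E') ∞ G} := fun k =>
    Nat.rec ⟨G₀, hG₀⟩ (fun k G => ⟨fun x => G.1 x + F k x • a k G,
      G.2.add ((hF.contMDiff k).smul contMDiff_const)⟩) k
  let b : ℕ → E' := fun k => a k (S k)
  have hS_succ : ∀ k x, (S (k + 1)).1 x = (S k).1 x + F k x • b k := fun k x => rfl
  have hS_sum : ∀ k x, (S k).1 x = G₀ x + ∑ j ∈ Finset.range k, F j x • b j := by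
    intro k x
    induction k with
    | zero => simp [S]
    | succ k ih => rw [hS_succ, ih, Finset.sum_range_succ, add_assoc]
  have hS_norm : ∀ k x, ‖(S k).1 x - G₀ x‖ ≤ 1 - (1 / 2) ^ k := by
    intro k x
    induction k with
    | zero => simp [S]
    | succ k ih =>
      have h1 : ‖F k x • b k‖ ≤ (1 / 2) ^ (k + 1) := by
        have hCk : |F k x| ≤ |C k| + 1 :=
          (hC k x).trans ((le_abs_self _).trans (le_add_of_nonneg_right zero_le_one))
        calc ‖F k x • b k‖ = |F k x| * ‖b k‖ := norm_smul _ _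
          _ ≤ (|C k| + 1) * ((1 / 2) ^ (k + 1) / (|C k| + 1)) :=
            mul_le_mul hCk (ha_norm k (S k)).le (norm_nonneg _) (by positivity)
          _ = (1 / 2) ^ (k + 1) := mul_div_cancel₀ _ (by positivity)
      calc ‖(S (k + 1)).1 x - G₀ x‖ = ‖((S k).1 x - G₀ x) + F k x • b k‖ := by
            rw [hS_succ, add_sub_right_comm]
        _ ≤ (1 - (1 / 2) ^ k) + (1 / 2) ^ (k + 1) := norm_add_le_of_le ih h1
        _ = 1 - (1 / 2) ^ (k + 1) := by ring
  have hS_inj : ∀ k x y, (S k).1 x = (S k).1 y → ∀ j < k, F j x = F j y := by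
    intro k x y
    induction k with
    | zero => intro _ j hj; exact absurd hj (Nat.not_lt_zero j)
    | succ k ih =>
      intro h j hj
      have hk : F k x = F k y := ha_inj k (S k) x y h
      rcases Nat.lt_succ_iff_lt_or_eq.1 hj with hj | rfl
      · rw [hS_succ, hS_succ, hk] at h
        exact ih (add_right_cancel h) j hj
      · exact hk
  have hS_der : ∀ k i, ∀ u ∈ (chartAt E (c i)).target, ∀ v : E,
      fderiv ℝ ((S k).1 ∘ (chartAt E (c i)).symm) u v = 0 →
        ∀ j < k, fderiv ℝ (F j ∘ (chartAt E (c i)).symm) u v = 0 := by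
    intro k i u hu v
    induction k with
    | zero => intro _ j hj; exact absurd hj (Nat.not_lt_zero j)
    | succ k ih =>
      intro h j hj
      have hk : fderiv ℝ (F k ∘ (chartAt E (c i)).symm) u v = 0 := ha_der k (S k) i u hu v h
      rcases Nat.lt_succ_iff_lt_or_eq.1 hj with hj | rfl
      · refine ih ?_ j hj
        have h1 := (((S k).2.contDiffAt_comp_chartAt_symm (c i) hu).differentiableAt
          (by simp)).hasFDerivAt
        have h2 := (((hF.contMDiff k).contDiffAt_comp_chartAt_symm (c i) hu).differentiableAt
          (by simp)).hasFDerivAt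
        have h3 := congrArg (fun L : E →L[ℝ] E' => L v) (h1.add (h2.smul_const (b k))).fderiv
        have h4 : fderiv ℝ ((S k).1 ∘ (chartAt E (c i)).symm) u v +
            fderiv ℝ (F k ∘ (chartAt E (c i)).symm) u v • b k = 0 := h3.symm.trans h
        rwa [hk, zero_smul, add_zero] at h4
      · exact hk
  let Ψ : M → E' := fun x => G₀ x + ∑ᶠ k, F k x • b k
  -- Local finiteness: near each point, `Ψ` is any sufficiently late stage.
  have hΨ : ∀ x, ∃ K, ∀ k ≥ K, Ψ =ᶠ[𝓝 x] (S k).1 := by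
    intro x
    obtain ⟨U, hU, hfin⟩ := hF.locallyFinite x
    obtain ⟨K, hK⟩ := hfin.bddAbove
    refine ⟨K + 1, fun k hk => ?_⟩
    filter_upwards [hU] with y hy
    rw [hS_sum]
    refine congrArg (G₀ y + ·) (finsum_eq_sum_of_support_subset _ fun j hj => ?_)
    have hjK : j ≤ K := hK ⟨y, left_ne_zero_of_smul hj, hy⟩
    exact Finset.mem_coe.2 (Finset.mem_range.2 (by omega))
  refine ⟨Ψ, fun x => ?_, fun x => ?_, fun x y hxy => ?_, fun x => ?_⟩
  · obtain ⟨K, hK⟩ := hΨ x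
    exact ((S K).2 x).congr_of_eventuallyEq (hK K le_rfl)
  · obtain ⟨K, hK⟩ := hΨ x
    rw [(hK K le_rfl).eq_of_nhds]
    exact (hS_norm K x).trans (sub_le_self _ (by positivity))
  · obtain ⟨K, hK⟩ := hΨ x
    obtain ⟨L, hL⟩ := hΨ y
    refine hF.eq_of_forall_eq x y fun j => ?_
    let k := max (max K L) (j + 1)
    have hkx := (hK k (by omega)).eq_of_nhds
    have hky := (hL k (by omega)).eq_of_nhds
    exact hS_inj k x y (by rw [← hkx, ← hky, hxy]) j (by omega)
  · obtain ⟨i, hi, hsep⟩ := hF.exists_chart x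
    obtain ⟨K, hK⟩ := hΨ x
    refine ⟨i, hi, (injective_iff_map_eq_zero _).2 fun v hv => hsep v fun j => ?_⟩
    have hu := (chartAt E (c i)).map_source hi
    have hcont := (chartAt E (c i)).continuousAt_symm hu
    rw [ContinuousAt, (chartAt E (c i)).left_inv hi] at hcont
    have hev : Ψ ∘ (chartAt E (c i)).symm =ᶠ[𝓝 (chartAt E (c i) x)]
        (S (max K (j + 1))).1 ∘ (chartAt E (c i)).symm :=
      hcont.eventually (hK _ (le_max_left _ _))
    rw [hev.fderiv_eq] at hv
    exact hS_der _ i _ hu v hv j (by omega)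

end Manifold

/-! ### Immersions -/

section Immersion

/-- The inverse function theorem, as a statement about charts of a vector space. -/
theorem exists_openPartialHomeomorph_symm_mem_maximalAtlas {V : Type*} [NormedAddCommGroup V]
    [NormedSpace ℝ V] [CompleteSpace V] {K : V → V} {U : Set V} (hU : IsOpen U)
    (hK : ContDiffOn ℝ ∞ K U) {w : V} (hw : w ∈ U) {A : V ≃L[ℝ] V}
    (hA : HasFDerivAt K (A : V →L[ℝ] V) w) :
    ∃ Φ : OpenPartialHomeomorph V V, w ∈ Φ.source ∧ ⇑Φ = K ∧
      Φ.symm ∈ IsManifold.maximalAtlas 𝓘(ℝ, V) ∞ V := by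
  have hKat : ∀ z ∈ U, ContDiffAt ℝ ∞ K z := fun z hz => hK.contDiffAt (hU.mem_nhds hz)
  let Φ₀ := (hKat w hw).toOpenPartialHomeomorph K hA (by simp)
  -- Smoothness of the inverse away from `w` needs an invertible derivative there as well.
  let W : Set V := U ∩ fderiv ℝ K ⁻¹' range ((↑) : (V ≃L[ℝ] V) → V →L[ℝ] V)
  have hW : IsOpen W := (hK.continuousOn_fderiv_of_isOpen hU (by simp)).isOpen_inter_preimage hU
    ContinuousLinearEquiv.isOpen
  let Φ := Φ₀.restrOpen W hW
  have hΦ : ⇑Φ = K := rfl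
  have hΦs : Φ.source = Φ₀.source ∩ W := Φ₀.restrOpen_source W hW
  have hsymm : ∀ z ∈ Φ.target, ContDiffAt ℝ ∞ Φ.symm z := by
    intro z hz
    have hzs : Φ.symm z ∈ W := (hΦs ▸ Φ.map_target hz).2
    obtain ⟨B, hB⟩ := hzs.2
    refine Φ.contDiffAt_symm (f₀' := B) hz ?_ (hKat _ hzs.1)
    rw [hB]
    exact ((hKat _ hzs.1).differentiableAt (by simp)).hasFDerivAt
  have hmem : Φ ∈ contDiffGroupoid ∞ 𝓘(ℝ, V) := by
    rw [contDiffGroupoid, mem_groupoid_of_pregroupoid]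
    constructor
    · have : ContDiffOn ℝ ∞ Φ Φ.source := hK.mono fun z hz => (hΦs ▸ hz).2.1
      simpa [contDiffPregroupoid] using this
    · have : ContDiffOn ℝ ∞ Φ.symm Φ.target := fun z hz => (hsymm z hz).contDiffWithinAt
      simpa [contDiffPregroupoid] using this
  refine ⟨Φ, ?_, hΦ, ?_⟩
  · rw [hΦs]
    exact ⟨(hKat w hw).mem_toOpenPartialHomeomorph_source hA (by simp), hw, A, hA.fderiv.symm⟩
  · exact StructureGroupoid.mem_maximalAtlas_of_mem_groupoid _ (StructureGroupoid.symm _ hmem)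

variable {E : Type*} [NormedAddCommGroup E] [NormedSpace ℝ E] [FiniteDimensional ℝ E]
  {E' : Type*} [NormedAddCommGroup E'] [NormedSpace ℝ E'] [FiniteDimensional ℝ E']
  {F : Type*} [NormedAddCommGroup F] [NormedSpace ℝ F] [FiniteDimensional ℝ F]
  {M : Type*} [TopologicalSpace M] [ChartedSpace E M] [IsManifold 𝓘(ℝ, E) ∞ M]

theorem ContinuousLinearMap.exists_continuousLinearEquiv_prod_extending
    (hdim : finrank ℝ E + finrank ℝ F = finrank ℝ E') (L : E →L[ℝ] E')
    (hL : Function.Injective L) : ∃ A : (E × F) ≃L[ℝ] E', ∀ v, A (v, 0) = L v := by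
  obtain ⟨q, hq⟩ := Submodule.exists_isCompl (LinearMap.range (L : E →ₗ[ℝ] E'))
  have hrange : finrank ℝ (LinearMap.range (L : E →ₗ[ℝ] E')) = finrank ℝ E :=
    LinearMap.finrank_range_of_inj hL
  have hqF : finrank ℝ F = finrank ℝ q := by
    have := Submodule.finrank_add_eq_of_isCompl hq
    omega
  refine ⟨(((LinearEquiv.ofInjective (L : E →ₗ[ℝ] E') hL).prodCongr
    (LinearEquiv.ofFinrankEq F q hqF)).trans
      (Submodule.prodEquivOfIsCompl _ q hq)).toContinuousLinearEquiv, fun v => ?_⟩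
  simp

/-- If `A : E × F ≃ E'` extends the differential of `Ψ` at `x`, read in a chart as `g`, then
`A (u, w) ↦ g u + A (0, w)` is a local diffeomorphism of `E'`. Its inverse is a chart of `E'` in
which `Ψ` becomes `u ↦ A (u, 0)`. -/
theorem ContMDiff.isImmersionAtOfComplement_of_injective_fderiv
    (hdim : finrank ℝ E + finrank ℝ F = finrank ℝ E') {Ψ : M → E'}
    (hΨ : ContMDiff 𝓘(ℝ, E) 𝓘(ℝ, E') ∞ Ψ) {x c : M} (hx : x ∈ (chartAt E c).source)
    (hinj : Function.Injective (fderiv ℝ (Ψ ∘ (chartAt E c).symm) (chartAt E c x))) :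
    Manifold.IsImmersionAtOfComplement F 𝓘(ℝ, E) 𝓘(ℝ, E') ∞ Ψ x := by
  let φ := chartAt E c
  let g : E → E' := Ψ ∘ φ.symm
  obtain ⟨A, hA⟩ := ContinuousLinearMap.exists_continuousLinearEquiv_prod_extending (F := F)
    hdim (fderiv ℝ g (φ x)) hinj
  let K : E' → E' := fun w => g (A.symm w).1 + A (0, (A.symm w).2)
  have hKA : ∀ u, K (A (u, 0)) = g u := fun u => by
    have : ((0 : E), (0 : F)) = 0 := rfl
    simp [K, this]
  let U : Set E' := (fun w => (A.symm w).1) ⁻¹' φ.target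
  have hU : IsOpen U := φ.open_target.preimage (by fun_prop)
  have hK : ContDiffOn ℝ ∞ K U := fun w hw => by
    have h1 : ContDiffAt ℝ ∞ g (A.symm w).1 := hΨ.contDiffAt_comp_chartAt_symm c hw
    have h2 : ContDiffAt ℝ ∞ (fun w => g (A.symm w).1) w :=
      ContDiffAt.comp (g := g) w h1 (by fun_prop : ContDiffAt ℝ ∞ (fun w => (A.symm w).1) w)
    have h3 : ContDiffAt ℝ ∞ (fun w => A (0, (A.symm w).2)) w := by fun_prop
    exact (h2.add h3).contDiffWithinAt
  have hwU : A (φ x, 0) ∈ U := by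
    simpa [U] using φ.map_source hx
  have hKd : HasFDerivAt K ((ContinuousLinearEquiv.refl ℝ E' : E' ≃L[ℝ] E') : E' →L[ℝ] E')
      (A (φ x, 0)) := by
    have h1 : HasFDerivAt g (fderiv ℝ g (φ x)) (A.symm (A (φ x, 0))).1 := by
      rw [A.symm_apply_apply]
      exact ((hΨ.contDiffAt_comp_chartAt_symm c (φ.map_source hx)).differentiableAt
        (by simp)).hasFDerivAt
    have h2 : HasFDerivAt (fun w => (A.symm w).1)
        ((ContinuousLinearMap.fst ℝ E F).comp (A.symm : E' →L[ℝ] E × F)) (A (φ x, 0)) :=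
      ((ContinuousLinearMap.fst ℝ E F).comp (A.symm : E' →L[ℝ] E × F)).hasFDerivAt
    have h3 : HasFDerivAt (fun w => A (0, (A.symm w).2))
        ((A : E × F →L[ℝ] E').comp ((ContinuousLinearMap.inr ℝ E F).comp
          ((ContinuousLinearMap.snd ℝ E F).comp (A.symm : E' →L[ℝ] E × F)))) (A (φ x, 0)) :=
      ((A : E × F →L[ℝ] E').comp ((ContinuousLinearMap.inr ℝ E F).comp
          ((ContinuousLinearMap.snd ℝ E F).comp (A.symm : E' →L[ℝ] E × F)))).hasFDerivAt
    refine ((HasFDerivAt.comp (g := g) (A (φ x, 0)) h1 h2).add h3).congr_fderiv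
      (ContinuousLinearMap.ext fun w => ?_)
    change fderiv ℝ g (φ x) (A.symm w).1 + A (0, (A.symm w).2) = w
    rw [← hA, ← map_add, Prod.mk_add_mk, add_zero, zero_add, Prod.mk.eta, A.apply_symm_apply]
  obtain ⟨Φ, hwΦ, hΦK, hΦ⟩ :=
    exists_openPartialHomeomorph_symm_mem_maximalAtlas hU hK hwU hKd
  let s : Set M := φ.source ∩ φ ⁻¹' ((fun u => A (u, 0)) ⁻¹' Φ.source)
  have hs : IsOpen s := φ.isOpen_inter_preimage (Φ.open_source.preimage (by fun_prop))
  have hΨx : Ψ x = Φ (A (φ x, 0)) := by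
    rw [hΦK, hKA]
    exact congrArg Ψ (φ.left_inv hx).symm
  refine Manifold.IsImmersionAtOfComplement.mk_of_continuousAt hΨ.continuous.continuousAt A
    (φ.restr s) Φ.symm ?_ ?_ ?_ hΦ ?_
  · rw [φ.restr_source, hs.interior_eq]
    exact ⟨hx, hx, hwΦ⟩
  · rw [hΨx]
    exact Φ.map_source hwΦ
  · exact restr_mem_maximalAtlas _ (IsManifold.chart_mem_maximalAtlas c) hs
  · intro u hu
    have hu' : u ∈ φ.target ∧ φ.symm u ∈ s := by
      simpa [hs.interior_eq] using hu
    have huΦ : A (u, 0) ∈ Φ.source := by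
      have := hu'.2.2
      rwa [mem_preimage, φ.right_inv hu'.1] at this
    change Φ.symm (Ψ (φ.symm u)) = A (u, 0)
    rw [show Ψ (φ.symm u) = Φ (A (u, 0)) by rw [hΦK, hKA]; rfl, Φ.left_inv huΦ]

end Immersion

/-! ### The embedding -/

theorem mainTheorem2 (n : ℕ) (M : Type*) [TopologicalSpace M]
    [ChartedSpace (EuclideanSpace ℝ (Fin n)) M] [IsManifold (𝓡 n) ∞ M]
    [ParacompactSpace M] [T2Space M] [ConnectedSpace M] :
    ∃ Ψ : M → EuclideanSpace ℝ (Fin (2 * n + 1)),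
      IsProperMap Ψ ∧ Manifold.IsSmoothEmbedding (𝓡 n) (𝓡 (2 * n + 1)) ∞ Ψ := by
  have : LocallyCompactSpace M :=
    ChartedSpace.locallyCompactSpace (EuclideanSpace ℝ (Fin n)) M
  have : SigmaCompactSpace M := sigmaCompactSpace_of_paracompactSpace_of_connectedSpace M
  obtain ⟨f, hf, hfc⟩ := exists_contMDiff_isCompact_sublevel (EuclideanSpace ℝ (Fin n)) M
  obtain ⟨s, F, hs, hF⟩ := exists_isSeparatingFamily (EuclideanSpace ℝ (Fin n)) M
  have : Countable s := hs.to_subtype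
  let e : EuclideanSpace ℝ (Fin (2 * n + 1)) := EuclideanSpace.single 0 1
  have he : ‖e‖ = 1 := by simp [e]
  obtain ⟨Ψ, hΨ, hΨf, hinj, himm⟩ := exists_contMDiff_injective_fderiv_injective_near
    (E' := EuclideanSpace ℝ (Fin (2 * n + 1))) (by simp) hF
    (hf.smul (contMDiff_const (c := e)))
  have hproper : IsProperMap Ψ := by
    refine isProperMap_iff_isCompact_preimage.2 ⟨hΨ.continuous, fun K hK => ?_⟩
    obtain ⟨R, hR⟩ := hK.isBounded.exists_norm_le
    refine (hfc (R + 1)).of_isClosed_subset (hK.isClosed.preimage hΨ.continuous) fun x hx => ?_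
    calc f x ≤ ‖f x • e‖ := by rw [norm_smul, he, mul_one]; exact le_abs_self _
      _ ≤ ‖Ψ x‖ + ‖Ψ x - f x • e‖ := by
        rw [norm_sub_rev]; exact norm_le_norm_add_norm_sub' _ _
      _ ≤ R + 1 := add_le_add (hR _ hx) (hΨf x)
  refine ⟨Ψ, hproper, ?_, (IsClosedEmbedding.of_continuous_injective_isClosedMap
    hΨ.continuous hinj hproper.isClosedMap).isEmbedding⟩
  -- An immersion is defined with one complement of the model space common to all points.
  refine Manifold.IsImmersionOfComplement.isImmersion
    (F := EuclideanSpace ℝ (Fin (n + 1))) fun x => ?_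
  obtain ⟨i, hi, hd⟩ := himm x
  refine hΨ.isImmersionAtOfComplement_of_injective_fderiv ?_ hi hd
  simp only [finrank_euclideanSpace_fin]
  omega
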